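/- Let $T>0$, $\lambda>0$. Let $N=(N(t))_{t\in[0,T]}$ be a homogeneous Poisson process with intensity $\lambda$ and let $Y_1,Y_2,\dots$ be i.i.d. positive random variables, independent of $N$, with distribution function $F$ and $\mathbb E[Y^2]<\infty$, where $Y\sim F$. Let $N(\mathrm ds,\mathrm dy)$ be the random measure with a unit mass at (arrival time, size) of each claim up to time $T$. Let $\xi:[\gamma_L,\gamma_H]\to[0,\infty)$ be a loading function, $0\le\gamma_L\le\gamma_H$. Let $\gamma\in[\gamma_L,\gamma_H]$, $\gamma>0$, be the customer's true risk aversion, $\tilde\gamma\in[\gamma_L,\gamma_H]$ the reported one, and $x_C>0$ the initial surplus. Coverage functions are deterministic measurable functions $l(t,y)$ on $[0,T]\times(0,\infty)$. The admissible set $\mathcal A_l$ is any set of such functions all of which satisfy $l\ge 0$ and $\int_0^T\!\int_0^\infty l(t,y)^2\,\mathrm dF(y)\,\mathrm dt<\infty$, and which contains every $l$ with $0\le l(t,y)\le y$. The premium rate is $p(l;\tilde\gamma)(t)=(1+\xi(\tilde\gamma))\lambda\int_0^\infty l(t,y)\,\mathrm dF(y)$. For $0\le t\le u\le T$, the surplus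 started from $x$ at time $t$ is $$X^{t,x}_C(u,l;\tilde\gamma)=x-\int_t^u p(l;\tilde\gamma)(s)\,\mathrm ds-\int_{(t,u]}\int_0^\infty (y-l(s,y))\,N(\mathrm ds,\mathrm dy),$$ and $J^\gamma(t,x,l;\tilde\gamma)=\mathbb E[X^{t,x}_C(T,l;\tilde\gamma)]-\frac{\gamma}{2}\mathrm{Var}[X^{t,x}_C(T,l;\tilde\gamma)]$. Put $V_C^\gamma(\tilde\gamma)=\sup_{l\in\mathcal A_l}J^\gamma(0,x_C,l;\tilde\gamma)$. A strategy $\hat l\in\mathcal A_l$ is an equilibrium strategy if $$\liminf_{\varepsilon\downarrow0}\frac{J^\gamma(t,x,\hat l;\tilde\gamma)-J^\gamma(t,x,l^\varepsilon;\tilde\gamma)}{\varepsilon}\ge0$$ for all $(t,x)\in[0,T]\times\mathbb R$ and all $\bar l$ such that the strategy $l^\varepsilon$ equal to $\bar l(y)$ at times in $[t,t+\varepsilon)$ and to $\hat l$ at other times is admissible for all small $\varepsilon>0$. **Theorem.** The random variable $X_C^{t,x}(T,l;\tilde\gamma)$ is square integrable for all $l\in\mathcal A_l$, $t\in[0,T]$,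 $x\in\mathbb R$. The coverage $$\hat l^\gamma(y;\tilde\gamma)=\Bigl(y-\frac{\xi(\tilde\gamma)}{\gamma}\Bigr)_+$$ is an equilibrium strategy, it attains the supremum defining $V_C^\gamma(\tilde\gamma)$, and the value function, which is also the value $J^\gamma(0,x_C,\hat l^\gamma;\tilde\gamma)$ of this equilibrium, is $$V_C^\gamma(\tilde\gamma)=x_C-\lambda T\left(\mathbb E[Y]+\xi(\tilde\gamma)\int_{(\xi(\tilde\gamma)/\gamma,\infty)}\Bigl(y-\frac{\xi(\tilde\gamma)}{\gamma}\Bigr)\mathrm dF(y)+\frac{\gamma}{2}\int_0^\infty\Bigl(y\wedge\frac{\xi(\tilde\gamma)}{\gamma}\Bigr)^2\mathrm dF(y)\right).$$ -/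

import Mathlib

open MeasureTheory ProbabilityTheory Set Filter
open scoped Topology

/-- `N = (N t)_{t ∈ [0,T]}` is a homogeneous Poisson process with intensity `lam`: it starts at `0`,
its paths are nondecreasing and right-continuous, its increments are independent, and
`N t - N s` is Poisson distributed with parameter `lam * (t - s)`. Only the times in `[0,T]`
matter. (The subtraction in `law` is that of `ℕ`; it is the true one as paths are monotone.) -/
structure IsPoissonProcess {Ω : Type*} [MeasurableSpace Ω] (P : Measure Ω) (T lam : ℝ)
    (N : ℝ → Ω → ℕ) : Prop where
  measurable : ∀ t ∈ Icc 0 T, Measurable (N t)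
  zero : ∀ᵐ ω ∂P, N 0 ω = 0
  mono : ∀ᵐ ω ∂P, MonotoneOn (fun t => N t ω) (Icc 0 T)
  rightCont : ∀ᵐ ω ∂P, ∀ t ∈ Ico 0 T, ContinuousWithinAt (fun s => N s ω) (Ici t) t
  indepIncrements : HasIndepIncrements (fun (t : Icc (0 : ℝ) T) ω => (N t ω : ℤ)) P
  law : ∀ s t, 0 ≤ s → s ≤ t → t ≤ T →
    HasLaw (fun ω => N t ω - N s ω) (poissonMeasure (lam * (t - s)).toNNReal) P

/-- The Cramér–Lundberg claim model on `[0,T]`: a Poisson process `N` of intensity `lam > 0`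
counting the claims, and an i.i.d. sequence of positive claim sizes with distribution `F` and finite
second moment, independent of `N`. The size of the `(i+1)`-st claim is `Y i`. -/
structure ClaimModel {Ω : Type*} [MeasurableSpace Ω] (P : Measure Ω) where
  T : ℝ
  lam : ℝ
  F : Measure ℝ
  N : ℝ → Ω → ℕ
  Y : ℕ → Ω → ℝ
  T_pos : 0 < T
  lam_pos : 0 < lam
  poisson : IsPoissonProcess P T lam N
  Y_law : ∀ i, HasLaw (Y i) F P
  Y_pos : ∀ i, ∀ᵐ ω ∂P, 0 < Y i ω
  Y_indep : iIndepFun Y P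
  Y_sq : Integrable (fun y : ℝ => y ^ 2) F
  N_Y_indep : IndepFun (fun ω (t : Icc (0 : ℝ) T) => N t ω) (fun ω i => Y i ω) P

/-- The excess-of-loss coverage `l(t,y) = (y - d)_+` with deductible `d`. -/
noncomputable def excessOfLoss (d : ℝ) : ℝ → ℝ → ℝ :=
  fun _ y => max (y - d) 0

namespace ClaimModel

variable {Ω : Type*} [MeasurableSpace Ω] {P : Measure Ω} (M : ClaimModel P)

/-- The arrival time of the `(i+1)`-st claim (meaningful when `i < N T`). -/
noncomputable def arrival (i : ℕ) (ω : Ω) : ℝ :=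
  sInf {s | s ∈ Icc 0 M.T ∧ i < M.N s ω}

/-- The random measure `N(ds, dy)` on `[0,T] × (0,∞)`: a unit mass at (arrival time, size) of each
claim that arrives up to time `T`. -/
noncomputable def jumpMeasure (ω : Ω) : Measure (ℝ × ℝ) :=
  ∑ i ∈ Finset.range (M.N M.T ω), Measure.dirac (M.arrival i ω, M.Y i ω)

/-- The largest class of coverage functions `l : [0,T] × (0,∞) → ℝ` considered (extended to `ℝ × ℝ`
in any measurable way): nonnegative and square integrable with respect to `ds ⊗ dF`. -/
structure IsCoverage (l : ℝ → ℝ → ℝ) : Prop where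
  measurable : Measurable (Function.uncurry l)
  nonneg : ∀ t ∈ Icc 0 M.T, ∀ y > 0, 0 ≤ l t y
  sq_integrable : Integrable (fun z : ℝ × ℝ => l z.1 z.2 ^ 2)
    ((volume.restrict (Icc 0 M.T)).prod M.F)

/-- Coverage functions that pay at most the loss: `0 ≤ l(t,y) ≤ y`. -/
structure IsIndemnity (l : ℝ → ℝ → ℝ) : Prop where
  measurable : Measurable (Function.uncurry l)
  bounds : ∀ t ∈ Icc 0 M.T, ∀ y > 0, 0 ≤ l t y ∧ l t y ≤ y

/-- The premium rate at time `t` for coverage `l` under the expected-value principle with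
risk loading `xi`. -/
noncomputable def premiumRate (xi : ℝ) (l : ℝ → ℝ → ℝ) (t : ℝ) : ℝ :=
  (1 + xi) * M.lam * ∫ y in Ioi 0, l t y ∂M.F

/-- The customer's surplus at time `u` when it equals `x` at time `t ≤ u`: premiums are paid
continuously on `[t,u]`, and the retained parts `y - l(s,y)` of the claims in `(t,u]` are borne. -/
noncomputable def surplusFrom (xi : ℝ) (l : ℝ → ℝ → ℝ) (t x u : ℝ) (ω : Ω) : ℝ :=
  x - (∫ s in t..u, M.premiumRate xi l s)
    - ∫ z in Ioc t u ×ˢ Ioi 0, (z.2 - l z.1 z.2) ∂M.jumpMeasure ω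

/-- The customer's surplus process `X_C(t,l)` with initial surplus `xC`. -/
noncomputable def surplus (xi xC : ℝ) (l : ℝ → ℝ → ℝ) (t : ℝ) (ω : Ω) : ℝ :=
  M.surplusFrom xi l 0 xC t ω

/-- The mean–variance criterion `J(t,x,l)` of the terminal surplus, given surplus `x` at time `t`. -/
noncomputable def J (xi γ : ℝ) (t x : ℝ) (l : ℝ → ℝ → ℝ) : ℝ :=
  (∫ ω, M.surplusFrom xi l t x M.T ω ∂P)
    - γ / 2 * variance (M.surplusFrom xi l t x M.T) P

/-- The customer's objective `E[X_C(T,l)] - (γ/2) Var[X_C(T,l)]`. -/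
noncomputable def objective (xi γ xC : ℝ) (l : ℝ → ℝ → ℝ) : ℝ :=
  (∫ ω, M.surplus xi xC l M.T ω ∂P) - γ / 2 * variance (M.surplus xi xC l M.T) P

/-- The customer's value function: the supremum (in the extended reals) of the objective over the
admissible set `A`. -/
noncomputable def valueFunction (A : Set (ℝ → ℝ → ℝ)) (xi γ xC : ℝ) : EReal :=
  ⨆ l ∈ A, ((M.objective xi γ xC l : ℝ) : EReal)

/-- The strategy that uses `lbar` on `[t, t+ε)` and `l` elsewhere. -/
noncomputable def perturb (l : ℝ → ℝ → ℝ) (lbar : ℝ → ℝ) (t ε : ℝ) : ℝ → ℝ → ℝ :=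
  fun s y => if t ≤ s ∧ s < t + ε then lbar y else l s y

/-- `l` is an equilibrium strategy within the admissible set `A`: for every `(t,x)` and every
perturbation `lbar` whose perturbed strategies are admissible for all small `ε > 0`,
`liminf_{ε → 0+} (J(t,x,l) - J(t,x,l^ε)) / ε ≥ 0` (a limes inferior in the extended reals). -/
def IsEquilibrium (A : Set (ℝ → ℝ → ℝ)) (xi γ : ℝ) (l : ℝ → ℝ → ℝ) : Prop :=
  l ∈ A ∧ ∀ t ∈ Icc 0 M.T, ∀ x : ℝ, ∀ lbar : ℝ → ℝ,
    (∀ᶠ ε in 𝓝[>] (0 : ℝ), perturb l lbar t ε ∈ A) →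
    0 ≤ liminf (fun ε : ℝ =>
      (((M.J xi γ t x l - M.J xi γ t x (perturb l lbar t ε)) / ε : ℝ) : EReal)) (𝓝[>] 0)

/-- The flow property: after time `t` the surplus process is the surplus restarted at time `t` from
its value there. This justifies `J` as the criterion conditioned on the surplus at time `t`. -/
theorem surplus_flow (xi xC : ℝ) (l : ℝ → ℝ → ℝ) (hl : Measurable (Function.uncurry l))
    {t u : ℝ} (ht : 0 ≤ t) (htu : t ≤ u)
    (h1 : IntervalIntegrable (M.premiumRate xi l) volume 0 t)
    (h2 : IntervalIntegrable (M.premiumRate xi l) volume t u) (ω : Ω) :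
    M.surplus xi xC l u ω = M.surplusFrom xi l t (M.surplus xi xC l t ω) u ω := by
  have hm : Measurable fun z : ℝ × ℝ => z.2 - l z.1 z.2 := measurable_snd.sub hl
  have hi : Integrable (fun z : ℝ × ℝ => z.2 - l z.1 z.2) (M.jumpMeasure ω) := by
    unfold jumpMeasure
    rw [integrable_finsetSum_measure]
    intro i _
    exact integrable_dirac (by simp)
  have hset : Ioc 0 u ×ˢ Ioi (0 : ℝ) = (Ioc 0 t ×ˢ Ioi (0 : ℝ)) ∪ (Ioc t u ×ˢ Ioi (0 : ℝ)) := by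
    rw [← union_prod, Ioc_union_Ioc_eq_Ioc ht htu]
  have hdisj : Disjoint (Ioc 0 t ×ˢ Ioi (0 : ℝ)) (Ioc t u ×ˢ Ioi (0 : ℝ)) :=
    Disjoint.set_prod_left (by simp) _ _
  unfold surplus surplusFrom
  rw [hset, setIntegral_union hdisj (measurableSet_Ioc.prod measurableSet_Ioi)
    hi.integrableOn hi.integrableOn, ← intervalIntegral.integral_add_adjacent_intervals h1 h2]
  ring

end ClaimModel

/-
A sum of `f` over the marked Poisson points (arrival time, claim size) has mean `∫ f ∂ν` and
variance `∫ f² ∂ν`, where `ν` is the intensity measure. Its first two moments only involve the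
intensity `ν` and the intensity `ν ⊗ ν` of pairs of distinct points. On the quadrants `(-∞, s]` and
`(-∞, s] × (-∞, t]` these two measures are moments of the counting process itself, and independent
marking preserves the product structure.

Hence `J(t, x, l)` is `x` minus the integral over the claims in `(t, T]`, with respect to their
intensity, of a cost which is quadratic in the amount covered. The coverage `(y - ξ/γ)₊` minimises
that cost claim by claim, so it is optimal from every `(t, x)`: there is no time inconsistency, and
the optimal strategy is an equilibrium.
-/

open scoped ENNReal

section IntegrableSeries

variable {ι Ω G : Type*} [MeasurableSpace Ω] {μ : Measure Ω} [NormedAddCommGroup G]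
  {f : ι → Ω → G}

lemma tsum_lintegral_enorm_ne_top (hf : ∀ i, Integrable (f i) μ)
    (hsum : Summable fun i => ∫ ω, ‖f i ω‖ ∂μ) : ∑' i, ∫⁻ ω, ‖f i ω‖ₑ ∂μ ≠ ∞ := by
  simp_rw [← fun i => ofReal_integral_norm_eq_lintegral_enorm (hf i)]
  exact hsum.tsum_ofReal_ne_top

variable [Countable ι]

lemma ae_summable_norm_of_summable_integral_norm (hf : ∀ i, Integrable (f i) μ)
    (hsum : Summable fun i => ∫ ω, ‖f i ω‖ ∂μ) : ∀ᵐ ω ∂μ, Summable fun i => ‖f i ω‖ :=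
  summable_norm_of_tsum_eLpNorm_ne_top le_rfl (fun i => (hf i).1)
    (by simpa only [eLpNorm_one_eq_lintegral_enorm] using tsum_lintegral_enorm_ne_top hf hsum)

lemma integrable_tsum_of_summable_integral_norm [CompleteSpace G] (hf : ∀ i, Integrable (f i) μ)
    (hsum : Summable fun i => ∫ ω, ‖f i ω‖ ∂μ) : Integrable (fun ω => ∑' i, f i ω) μ := by
  refine ⟨aestronglyMeasurable_of_tendsto_ae atTop
    (fun s : Finset ι => Finset.aestronglyMeasurable_fun_sum s fun i _ => (hf i).1) ?_, ?_⟩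
  · filter_upwards [ae_summable_norm_of_summable_integral_norm hf hsum] with ω hω
    exact hω.of_norm.hasSum
  · calc ∫⁻ ω, ‖∑' i, f i ω‖ₑ ∂μ ≤ ∫⁻ ω, ∑' i, ‖f i ω‖ₑ ∂μ :=
        lintegral_mono fun ω => enorm_tsum_le_tsum_enorm
      _ = ∑' i, ∫⁻ ω, ‖f i ω‖ₑ ∂μ := lintegral_tsum fun i => (hf i).1.enorm
      _ < ∞ := (tsum_lintegral_enorm_ne_top hf hsum).lt_top

end IntegrableSeries

lemma sq_tsum_eq_tsum_sq_add_tsum_offDiag {ι : Type*} {a : ι → ℝ} (ha : Summable fun i => ‖a i‖) :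
    (∑' i, a i) ^ 2 = ∑' i, a i ^ 2 + ∑' p : {p : ι × ι // p.1 ≠ p.2}, a p.1.1 * a p.1.2 := by
  rw [sq, tsum_mul_tsum_of_summable_norm ha ha,
    ← (summable_mul_of_summable_norm ha ha).tsum_subtype_add_tsum_subtype_compl (diagonal ι)]
  congr 1
  rw [← range_diag, tsum_range (fun p : ι × ι => a p.1 * a p.2) fun _ _ h => congrArg Prod.fst h]
  exact tsum_congr fun i => (sq (a i)).symm

section PointProcess

variable {ι Ω E : Type*} [MeasurableSpace Ω] [MeasurableSpace E]

/-- The intensity measure of the point process on `E` whose point `x i ω`, for `i : ι`, is present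
on the event `A i`. -/
noncomputable def intensityMeasure (P : Measure Ω) (A : ι → Set Ω) (x : ι → Ω → E) : Measure E :=
  Measure.sum fun i => (P.restrict (A i)).map (x i)

/-- The sum of `f` over the points of the point process with points `x i`, present on `A i`. -/
noncomputable def shotNoise (A : ι → Set Ω) (x : ι → Ω → E) (f : E → ℝ) (ω : Ω) : ℝ :=
  ∑' i, (A i).indicator (fun ω => f (x i ω)) ω

/-- The events on which two distinct points of a point process are both present. -/
def pairEvent (A : ι → Set Ω) (p : {p : ι × ι // p.1 ≠ p.2}) : Set Ω :=
  A p.1.1 ∩ A p.1.2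

/-- The pairs of distinct points of a point process. -/
def pairPoint (x : ι → Ω → E) (p : {p : ι × ι // p.1 ≠ p.2}) (ω : Ω) : E × E :=
  (x p.1.1 ω, x p.1.2 ω)

/-- The point process with points `x i`, present on `A i`, has the first and second factorial moment
measures `ν` and `ν ⊗ ν` of a Poisson point process with intensity `ν`. -/
structure HasPoissonMoments (P : Measure Ω) (A : ι → Set Ω) (x : ι → Ω → E) (ν : Measure E) :
    Prop where
  measurableSet : ∀ i, MeasurableSet (A i)
  aemeasurable : ∀ i, AEMeasurable (x i) (P.restrict (A i))
  intensity_eq : intensityMeasure P A x = ν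
  pairIntensity_eq : intensityMeasure P (pairEvent A) (pairPoint x) = ν.prod ν

variable {P : Measure Ω} {A : ι → Set Ω} {x : ι → Ω → E}

lemma measurableSet_pairEvent (hA : ∀ i, MeasurableSet (A i)) (p : {p : ι × ι // p.1 ≠ p.2}) :
    MeasurableSet (pairEvent A p) :=
  (hA _).inter (hA _)

lemma aemeasurable_pairPoint (hx : ∀ i, AEMeasurable (x i) (P.restrict (A i)))
    (p : {p : ι × ι // p.1 ≠ p.2}) :
    AEMeasurable (pairPoint x p) (P.restrict (pairEvent A p)) :=
  ((hx _).mono_measure (Measure.restrict_mono_set P inter_subset_left)).prodMk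
    ((hx _).mono_measure (Measure.restrict_mono_set P inter_subset_right))

lemma HasPoissonMoments.congr {ν : Measure E} (h : HasPoissonMoments P A x ν) {x' : ι → Ω → E}
    (hx : ∀ i, x' i =ᵐ[P.restrict (A i)] x i) : HasPoissonMoments P A x' ν where
  measurableSet := h.measurableSet
  aemeasurable i := (h.aemeasurable i).congr (hx i).symm
  intensity_eq := by
    rw [← h.intensity_eq]
    exact congrArg Measure.sum (funext fun i => Measure.map_congr (hx i))
  pairIntensity_eq := by
    rw [← h.pairIntensity_eq]
    refine congrArg Measure.sum (funext fun p => Measure.map_congr ?_)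
    filter_upwards [ae_mono (Measure.restrict_mono_set P inter_subset_left) (hx p.1.1),
      ae_mono (Measure.restrict_mono_set P inter_subset_right) (hx p.1.2)] with ω hi hj
    exact Prod.ext hi hj

lemma intensityMeasure_apply [Countable ι] (hA : ∀ i, MeasurableSet (A i))
    (hx : ∀ i, AEMeasurable (x i) (P.restrict (A i))) {s : Set E} (hs : MeasurableSet s) :
    intensityMeasure P A x s = ∫⁻ ω, ({i | ω ∈ A i ∧ x i ω ∈ s}.encard : ℝ≥0∞) ∂P := by
  have hnull i : NullMeasurableSet (x i ⁻¹' s ∩ A i) P :=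
    (nullMeasurableSet_restrict (hA i).nullMeasurableSet).1 ((hx i).nullMeasurable hs)
  have hmeas i : AEMeasurable ((x i ⁻¹' s ∩ A i).indicator (1 : Ω → ℝ≥0∞)) P :=
    aemeasurable_one.indicator₀ (hnull i)
  have hcard ω : ({i | ω ∈ A i ∧ x i ω ∈ s}.encard : ℝ≥0∞)
      = ∑' i, (x i ⁻¹' s ∩ A i).indicator 1 ω := by
    rw [← ENNReal.tsum_set_one, tsum_subtype _ fun _ => (1 : ℝ≥0∞)]
    refine tsum_congr fun i => ?_
    by_cases hi : ω ∈ A i <;> by_cases his : x i ω ∈ s <;> simp [hi, his]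
  simp_rw [hcard]
  rw [intensityMeasure, Measure.sum_apply _ hs, lintegral_tsum hmeas]
  refine tsum_congr fun i => ?_
  rw [Measure.map_apply_of_aemeasurable (hx i) hs, Measure.restrict_apply' (hA i),
    lintegral_indicator_one₀ (hnull i)]

section ShotNoise

variable {f : E → ℝ}

lemma integrable_indicator_point (hA : ∀ i, MeasurableSet (A i))
    (hx : ∀ i, AEMeasurable (x i) (P.restrict (A i)))
    (hf : Integrable f (intensityMeasure P A x)) (i : ι) :
    Integrable ((A i).indicator fun ω => f (x i ω)) P :=
  (integrable_indicator_iff (hA i)).2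
    ((hf.mono_measure (Measure.le_sum _ i)).comp_aemeasurable (hx i))

lemma summable_integral_norm_indicator_point (hA : ∀ i, MeasurableSet (A i))
    (hx : ∀ i, AEMeasurable (x i) (P.restrict (A i)))
    (hf : Integrable f (intensityMeasure P A x)) :
    Summable fun i => ∫ ω, ‖(A i).indicator (fun ω => f (x i ω)) ω‖ ∂P := by
  have hnorm i : ∫ ω, ‖(A i).indicator (fun ω => f (x i ω)) ω‖ ∂P
      = ∫ z, ‖f z‖ ∂(P.restrict (A i)).map (x i) := by
    rw [integral_map (hx i) (hf.mono_measure (Measure.le_sum _ i)).norm.1]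
    simp_rw [norm_indicator_eq_indicator_norm]
    exact integral_indicator (hA i)
  simpa only [hnorm] using hf.summable_integral

variable [Countable ι]

lemma ae_summable_norm_shotNoise (hA : ∀ i, MeasurableSet (A i))
    (hx : ∀ i, AEMeasurable (x i) (P.restrict (A i)))
    (hf : Integrable f (intensityMeasure P A x)) :
    ∀ᵐ ω ∂P, Summable fun i => ‖(A i).indicator (fun ω => f (x i ω)) ω‖ :=
  ae_summable_norm_of_summable_integral_norm (integrable_indicator_point hA hx hf)
    (summable_integral_norm_indicator_point hA hx hf)

lemma integrable_shotNoise (hA : ∀ i, MeasurableSet (A i))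
    (hx : ∀ i, AEMeasurable (x i) (P.restrict (A i)))
    (hf : Integrable f (intensityMeasure P A x)) : Integrable (shotNoise A x f) P :=
  integrable_tsum_of_summable_integral_norm (integrable_indicator_point hA hx hf)
    (summable_integral_norm_indicator_point hA hx hf)

lemma integral_shotNoise (hA : ∀ i, MeasurableSet (A i))
    (hx : ∀ i, AEMeasurable (x i) (P.restrict (A i)))
    (hf : Integrable f (intensityMeasure P A x)) :
    ∫ ω, shotNoise A x f ω ∂P = ∫ z, f z ∂intensityMeasure P A x := by
  refine Eq.trans (integral_tsum_of_summable_integral_norm (integrable_indicator_point hA hx hf)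
    (summable_integral_norm_indicator_point hA hx hf)).symm ?_
  rw [intensityMeasure, integral_sum_measure hf]
  refine tsum_congr fun i => ?_
  rw [integral_indicator (hA i), integral_map (hx i) (hf.mono_measure (Measure.le_sum _ i)).1]

lemma sq_shotNoise_ae_eq (hA : ∀ i, MeasurableSet (A i))
    (hx : ∀ i, AEMeasurable (x i) (P.restrict (A i)))
    (hf : Integrable f (intensityMeasure P A x)) :
    (fun ω => shotNoise A x f ω ^ 2) =ᵐ[P] fun ω => shotNoise A x (fun z => f z ^ 2) ω
      + shotNoise (pairEvent A) (pairPoint x) (fun z => f z.1 * f z.2) ω := by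
  filter_upwards [ae_summable_norm_shotNoise hA hx hf] with ω hω
  rw [shotNoise, sq_tsum_eq_tsum_sq_add_tsum_offDiag hω]
  refine congrArg₂ _ (tsum_congr fun i => ?_) (tsum_congr fun p => ?_)
  · by_cases h : ω ∈ A i <;> simp [h]
  · exact (inter_indicator_mul (fun ω => f (x p.1.1 ω)) (fun ω => f (x p.1.2 ω)) ω).symm

namespace HasPoissonMoments

variable {ν : Measure E}

lemma integral_shotNoise (h : HasPoissonMoments P A x ν) (hf : Integrable f ν) :
    ∫ ω, shotNoise A x f ω ∂P = ∫ z, f z ∂ν := by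
  rw [← h.intensity_eq] at hf ⊢
  exact _root_.integral_shotNoise h.measurableSet h.aemeasurable hf

lemma integrable_shotNoise_sq (h : HasPoissonMoments P A x ν) (hf : MemLp f 2 ν) :
    Integrable (shotNoise A x fun z => f z ^ 2) P :=
  integrable_shotNoise h.measurableSet h.aemeasurable (h.intensity_eq ▸ hf.integrable_sq)

lemma integrable_shotNoise_mul (h : HasPoissonMoments P A x ν) (hf : Integrable f ν) :
    Integrable (shotNoise (pairEvent A) (pairPoint x) fun z => f z.1 * f z.2) P :=
  integrable_shotNoise (measurableSet_pairEvent h.measurableSet)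
    (aemeasurable_pairPoint h.aemeasurable)
    (h.pairIntensity_eq ▸ hf.mul_prod hf)

lemma integral_shotNoise_mul [SFinite ν] (h : HasPoissonMoments P A x ν) (hf : Integrable f ν) :
    ∫ ω, shotNoise (pairEvent A) (pairPoint x) (fun z => f z.1 * f z.2) ω ∂P
      = (∫ z, f z ∂ν) ^ 2 := by
  rw [_root_.integral_shotNoise (measurableSet_pairEvent h.measurableSet)
    (aemeasurable_pairPoint h.aemeasurable)
    (h.pairIntensity_eq ▸ hf.mul_prod hf), h.pairIntensity_eq, integral_prod_mul, sq]

lemma memLp_shotNoise (h : HasPoissonMoments P A x ν) (hf : Integrable f ν) (hf2 : MemLp f 2 ν) :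
    MemLp (shotNoise A x f) 2 P := by
  have hf' : Integrable f (intensityMeasure P A x) := h.intensity_eq ▸ hf
  rw [memLp_two_iff_integrable_sq (integrable_shotNoise h.measurableSet h.aemeasurable hf').1]
  exact ((h.integrable_shotNoise_sq hf2).add (h.integrable_shotNoise_mul hf)).congr
    (sq_shotNoise_ae_eq h.measurableSet h.aemeasurable hf').symm

lemma integral_sq_shotNoise [SFinite ν] (h : HasPoissonMoments P A x ν) (hf : Integrable f ν)
    (hf2 : MemLp f 2 ν) :
    ∫ ω, shotNoise A x f ω ^ 2 ∂P = ∫ z, f z ^ 2 ∂ν + (∫ z, f z ∂ν) ^ 2 := by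
  rw [integral_congr_ae (sq_shotNoise_ae_eq h.measurableSet h.aemeasurable (h.intensity_eq ▸ hf)),
    integral_add (h.integrable_shotNoise_sq hf2) (h.integrable_shotNoise_mul hf),
    h.integral_shotNoise hf2.integrable_sq, h.integral_shotNoise_mul hf]

lemma variance_shotNoise [IsProbabilityMeasure P] [SFinite ν] (h : HasPoissonMoments P A x ν)
    (hf : Integrable f ν) (hf2 : MemLp f 2 ν) :
    variance (shotNoise A x f) P = ∫ z, f z ^ 2 ∂ν := by
  rw [variance_eq_sub (h.memLp_shotNoise hf hf2)]
  simp only [Pi.pow_apply]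
  rw [h.integral_sq_shotNoise hf hf2, h.integral_shotNoise hf, add_sub_cancel_right]

end HasPoissonMoments

end ShotNoise

section Marking

variable {α E' : Type*} [MeasurableSpace α] [MeasurableSpace E']

lemma map_restrict_preimage_prodMk [IsFiniteMeasure P] {W : Ω → α} {Z : Ω → E'} {B : Set α}
    {a : α → E} (hW : Measurable W) (hZ : AEMeasurable Z P) (hB : MeasurableSet B)
    (ha : Measurable a) (hWZ : IndepFun W Z P) :
    (P.restrict (W ⁻¹' B)).map (fun ω => (a (W ω), Z ω))
      = ((P.restrict (W ⁻¹' B)).map fun ω => a (W ω)).prod (P.map Z) := by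
  have hrestrict : (P.restrict (W ⁻¹' B)).map (fun ω => (W ω, Z ω))
      = ((P.map W).restrict B).prod (P.map Z) := by
    rw [← Measure.restrict_univ (μ := P.map Z), Measure.prod_restrict,
      ← (indepFun_iff_map_prod_eq_prod_map_map hW.aemeasurable hZ).1 hWZ,
      Measure.restrict_map_of_aemeasurable (hW.aemeasurable.prodMk hZ) (hB.prod .univ)]
    congr 2
    ext ω
    simp
  change Measure.map _ _ = (Measure.map (a ∘ W) _).prod _
  rw [← Measure.map_map ha hW, ← Measure.restrict_map hW hB, ← Measure.map_id (μ := P.map Z),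
    Measure.map_prod_map _ _ ha measurable_id, ← hrestrict,
    AEMeasurable.map_map_of_aemeasurable (ha.prodMap measurable_id).aemeasurable
      (hW.aemeasurable.prodMk hZ.restrict)]
  rfl

lemma measurePreserving_prodProdProdComm {α₁ α₂ β₁ β₂ : Type*} [MeasurableSpace α₁]
    [MeasurableSpace α₂] [MeasurableSpace β₁] [MeasurableSpace β₂] (μ₁ : Measure α₁)
    (μ₂ : Measure α₂) (ν₁ : Measure β₁) (ν₂ : Measure β₂) [SFinite μ₁] [SFinite μ₂] [SFinite ν₁]
    [SFinite ν₂] :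
    MeasurePreserving (Equiv.prodProdProdComm α₁ α₂ β₁ β₂) ((μ₁.prod μ₂).prod (ν₁.prod ν₂))
      ((μ₁.prod ν₁).prod (μ₂.prod ν₂)) := by
  have hmiddle : MeasurePreserving (fun z : α₂ × β₁ × β₂ => (z.2.1, z.1, z.2.2))
      (μ₂.prod (ν₁.prod ν₂)) (ν₁.prod (μ₂.prod ν₂)) :=
    (measurePreserving_prodAssoc ν₁ μ₂ ν₂).comp
      ((Measure.measurePreserving_swap.prod (.id ν₂)).comp
        (measurePreserving_prodAssoc μ₂ ν₁ ν₂).symm)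
  exact ((measurePreserving_prodAssoc μ₁ ν₁ _).symm).comp
    (((MeasurePreserving.id μ₁).prod hmiddle).comp (measurePreserving_prodAssoc μ₁ μ₂ _))

variable [IsFiniteMeasure P] {W : Ω → α} {B : ι → Set α} {a : ι → α → E} {Y : ι → Ω → E'}
  {F : Measure E'}

lemma map_pairPoint_prodMk (hW : Measurable W) (hB : ∀ i, MeasurableSet (B i))
    (ha : ∀ i, Measurable (a i)) (hY : ∀ i, HasLaw (Y i) F P)
    (hYY : Pairwise fun i j => IndepFun (Y i) (Y j) P) (hWY : IndepFun W (fun ω i => Y i ω) P)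
    (p : {p : ι × ι // p.1 ≠ p.2}) :
    (P.restrict (pairEvent (fun i => W ⁻¹' B i) p)).map
        (pairPoint (fun i ω => (a i (W ω), Y i ω)) p)
      = (((P.restrict (pairEvent (fun i => W ⁻¹' B i) p)).map
          (pairPoint (fun i ω => a i (W ω)) p)).prod (F.prod F)).map
        (Equiv.prodProdProdComm E E E' E') := by
  obtain ⟨⟨i, j⟩, hij⟩ := p
  have hYij : AEMeasurable (fun ω => (Y i ω, Y j ω)) P :=
    (hY i).aemeasurable.prodMk (hY j).aemeasurable
  have haij : Measurable fun w => (a i w, a j w) := (ha i).prodMk (ha j)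
  have hshuffle : Measurable (Equiv.prodProdProdComm E E E' E') :=
    (measurable_fst.fst.prodMk measurable_snd.fst).prodMk
      (measurable_fst.snd.prodMk measurable_snd.snd)
  have hlaw : P.map (fun ω => (Y i ω, Y j ω)) = F.prod F := by
    rw [(indepFun_iff_map_prod_eq_prod_map_map (hY i).aemeasurable (hY j).aemeasurable).1
      (hYY hij), (hY i).map_eq, (hY j).map_eq]
  have hpairs := map_restrict_preimage_prodMk hW hYij ((hB i).inter (hB j)) haij
    (hWY.comp measurable_id ((measurable_pi_apply i).prodMk (measurable_pi_apply j)))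
  rw [hlaw] at hpairs
  refine Eq.trans ?_ (congrArg (Measure.map (Equiv.prodProdProdComm E E E' E')) hpairs)
  exact (AEMeasurable.map_map_of_aemeasurable hshuffle.aemeasurable
    ((haij.comp hW).aemeasurable.prodMk hYij.restrict)).symm

lemma HasPoissonMoments.marked {ν : Measure E} [SFinite ν] [SFinite F]
    (h : HasPoissonMoments P (fun i => W ⁻¹' B i) (fun i ω => a i (W ω)) ν)
    (hW : Measurable W) (hB : ∀ i, MeasurableSet (B i)) (ha : ∀ i, Measurable (a i))
    (hY : ∀ i, HasLaw (Y i) F P) (hYY : Pairwise fun i j => IndepFun (Y i) (Y j) P)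
    (hWY : IndepFun W (fun ω i => Y i ω) P) :
    HasPoissonMoments P (fun i => W ⁻¹' B i) (fun i ω => (a i (W ω), Y i ω)) (ν.prod F) where
  measurableSet := h.measurableSet
  aemeasurable i := (h.aemeasurable i).prodMk (hY i).aemeasurable.restrict
  intensity_eq := by
    rw [← h.intensity_eq, intensityMeasure, intensityMeasure, Measure.prod_sum_left]
    refine congrArg Measure.sum (funext fun i => ?_)
    rw [map_restrict_preimage_prodMk hW (hY i).aemeasurable (hB i) (ha i)
      (hWY.comp measurable_id (measurable_pi_apply i)), (hY i).map_eq]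
  pairIntensity_eq := by
    have hshuffle := measurePreserving_prodProdProdComm ν ν F F
    simp_rw [intensityMeasure, map_pairPoint_prodMk hW hB ha hY hYY hWY]
    rw [← Measure.map_sum hshuffle.measurable.aemeasurable, ← Measure.prod_sum_left,
      ← intensityMeasure, h.pairIntensity_eq, hshuffle.map_eq]

end Marking

end PointProcess

section PoissonLaw

lemma lintegral_natCast_mul_poissonMeasure (r : NNReal) (f : ℕ → ℝ≥0∞) :
    ∫⁻ n, (n : ℝ≥0∞) * f n ∂poissonMeasure r = r * ∫⁻ n, f (n + 1) ∂poissonMeasure r := by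
  have hweight (n : ℕ) :
      ENNReal.ofReal (Real.exp (-r) * r ^ (n + 1) / (n + 1).factorial) * ((n + 1 : ℕ) : ℝ≥0∞)
        = r * ENNReal.ofReal (Real.exp (-r) * r ^ n / n.factorial) := by
    rw [← ENNReal.ofReal_natCast, ← ENNReal.ofReal_coe_nnreal (p := r),
      ← ENNReal.ofReal_mul (by positivity), ← ENNReal.ofReal_mul (by positivity),
      Nat.factorial_succ]
    congr 1
    push_cast
    field_simp
    ring
  rw [lintegral_countable', lintegral_countable', tsum_eq_zero_add' ENNReal.summable,
    ← ENNReal.tsum_mul_left]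
  simp only [Nat.cast_zero, zero_mul, zero_add, poissonMeasure_singleton]
  refine tsum_congr fun n => ?_
  rw [mul_right_comm, mul_comm _ (ENNReal.ofReal _), hweight]
  ring

lemma lintegral_natCast_poissonMeasure (r : NNReal) :
    ∫⁻ n, (n : ℝ≥0∞) ∂poissonMeasure r = r := by
  simpa using lintegral_natCast_mul_poissonMeasure r 1

lemma lintegral_natCast_mul_pred_poissonMeasure (r : NNReal) :
    ∫⁻ n, (n : ℝ≥0∞) * (n - 1 : ℕ) ∂poissonMeasure r = (r : ℝ≥0∞) * r := by
  rw [lintegral_natCast_mul_poissonMeasure r fun n => ((n - 1 : ℕ) : ℝ≥0∞)]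
  simp_rw [add_tsub_cancel_right]
  rw [lintegral_natCast_poissonMeasure]

end PoissonLaw

lemma encard_offDiag_lt_lt (m k : ℕ) :
    {p : {p : ℕ × ℕ // p.1 ≠ p.2} | p.1.1 < m ∧ p.1.2 < k}.encard = (m * k - min m k : ℕ) := by
  have hdiag : ((Finset.range m ×ˢ Finset.range k).filter fun p => p.1 = p.2)
      = (Finset.range (min m k)).map ⟨_, Function.diag_injective⟩ := by
    ext ⟨i, j⟩
    simp only [Finset.mem_filter, Finset.mem_product, Finset.mem_range, Finset.mem_map, lt_inf_iff,
      Function.Embedding.coeFn_mk, Function.diag_apply, Prod.mk.injEq, exists_eq_right_right]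
    grind
  have hoff := Finset.card_filter_add_card_filter_not (s := Finset.range m ×ˢ Finset.range k)
    (fun p : ℕ × ℕ => p.1 = p.2)
  rw [hdiag, Finset.card_map, Finset.card_product] at hoff
  simp only [Finset.card_range] at hoff
  rw [← Subtype.val_injective.encard_image, ← hoff, Nat.add_sub_cancel_left,
    ← encard_coe_eq_coe_finsetCard]
  congr 1
  ext p
  simp

lemma prod_eq_of_Iic {μ ν : Measure ℝ} [IsFiniteMeasure μ] [IsFiniteMeasure ν]
    {ρ : Measure (ℝ × ℝ)} (h : ∀ s t, ρ (Iic s ×ˢ Iic t) = μ (Iic s) * ν (Iic t)) :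
    ρ = μ.prod ν := by
  have hspan (κ : Measure ℝ) [IsFiniteMeasure κ] : κ.FiniteSpanningSetsIn (range Iic) :=
    ⟨fun n => Iic n, fun n => ⟨n, rfl⟩, fun n => measure_lt_top κ _,
      iUnion_Iic_of_not_bddAbove_range (not_bddAbove_of_tendsto_atTop tendsto_natCast_atTop_atTop)⟩
  have hgen : MeasurableSpace.generateFrom (range Iic) = borel ℝ :=
    (borel_eq_generateFrom_Iic ℝ).symm
  refine (Measure.prod_eq_generateFrom (hgen.trans (BorelSpace.measurable_eq).symm)
    (hgen.trans (BorelSpace.measurable_eq).symm) isPiSystem_Iic isPiSystem_Iic (hspan μ) (hspan ν)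
    ?_).symm
  rintro _ ⟨s, rfl⟩ _ ⟨t, rfl⟩
  exact h s t

section CountingPath

/-- `f` is a path on `[0,T]` of a counting process: it starts at `0`, is nondecreasing and is
right-continuous. -/
structure IsCountingPath (T : ℝ) (f : ℝ → ℕ) : Prop where
  zero : f 0 = 0
  mono : MonotoneOn f (Icc 0 T)
  rightCont : ∀ t ∈ Ico 0 T, ContinuousWithinAt f (Ici t) t

/-- The first time in `[0,T]` at which `f` exceeds `i`. It has the junk value `0` when there is no
such time. -/
noncomputable def firstPassage (T : ℝ) (f : ℝ → ℕ) (i : ℕ) : ℝ :=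
  sInf {s | s ∈ Icc 0 T ∧ i < f s}

/-- The first passage time of a nondecreasing path above `i`, evaluated along rational times. This
makes it a measurable function of the path. -/
noncomputable def ratFirstPassage {T : ℝ} (hT : 0 ≤ T) (i : ℕ) (w : Icc 0 T → ℕ) : ℝ :=
  ⨅ q : ℚ, if i < w (projIcc 0 T hT q) then (projIcc 0 T hT q : ℝ) else T

variable {T : ℝ} {f : ℝ → ℕ} {i : ℕ}

lemma measurable_ratFirstPassage (hT : 0 ≤ T) (i : ℕ) : Measurable (ratFirstPassage hT i) :=
  Measurable.iInf fun _ => Measurable.ite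
    (measurableSet_lt measurable_const (measurable_pi_apply _)) measurable_const measurable_const

lemma firstPassage_le {s : ℝ} (hs : s ∈ Icc 0 T) (hi : i < f s) : firstPassage T f i ≤ s :=
  csInf_le ⟨0, fun _ hu => hu.1.1⟩ ⟨hs, hi⟩

lemma exists_lt_of_firstPassage_lt (hT : 0 ≤ T) (hi : i < f T) {b : ℝ}
    (hb : firstPassage T f i < b) : ∃ s ∈ Icc 0 T, i < f s ∧ s < b := by
  obtain ⟨s, ⟨hs, his⟩, hsb⟩ := exists_lt_of_csInf_lt (s := {s | s ∈ Icc 0 T ∧ i < f s})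
    ⟨T, right_mem_Icc.2 hT, hi⟩ hb
  exact ⟨s, hs, his, hsb⟩

lemma firstPassage_eq_ratFirstPassage (hT : 0 ≤ T) (hf : MonotoneOn f (Icc 0 T)) (hi : i < f T) :
    firstPassage T f i = ratFirstPassage hT i fun t => f t := by
  have hle (q : ℚ) : firstPassage T f i
      ≤ if i < f (projIcc 0 T hT q) then (projIcc 0 T hT q : ℝ) else T := by
    split_ifs with h
    · exact firstPassage_le (projIcc 0 T hT q).2 h
    · exact firstPassage_le (right_mem_Icc.2 hT) hi
  refine le_antisymm (le_ciInf hle) (le_of_forall_gt_imp_ge_of_dense fun b hb => ?_)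
  obtain ⟨s, hs, his, hsb⟩ := exists_lt_of_firstPassage_lt hT hi hb
  obtain ⟨q, hsq, hqb⟩ := exists_rat_btwn hsb
  have hsq' : s ≤ projIcc 0 T hT q := le_max_of_le_right (le_min hs.2 hsq.le)
  refine (ciInf_le ⟨_, forall_mem_range.2 hle⟩ q).trans ?_
  rw [if_pos (his.trans_le (hf hs (projIcc 0 T hT q).2 hsq'))]
  exact (max_le (hs.1.trans hsq.le) (min_le_right _ _)).trans hqb.le

namespace IsCountingPath

lemma firstPassage_le_iff_of_mem (h : IsCountingPath T f) (hi : i < f T) {t : ℝ}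
    (ht : t ∈ Icc 0 T) : firstPassage T f i ≤ t ↔ i < f t := by
  refine ⟨fun hle => ?_, firstPassage_le ht⟩
  rcases ht.2.eq_or_lt with rfl | htT
  · exact hi
  have hconst : ∀ᶠ s in 𝓝[>] t, f s = f t :=
    nhdsWithin_mono t Ioi_subset_Ici_self
      ((h.rightCont t ⟨ht.1, htT⟩).eventually (p := (· = f t)) (by simp [nhds_discrete]))
  obtain ⟨s, hs, hts, hsT⟩ := (hconst.and (Ioo_mem_nhdsGT htT)).exists
  obtain ⟨u, hu, hiu, hus⟩ :=
    exists_lt_of_firstPassage_lt (ht.1.trans ht.2) hi (hle.trans_lt hts)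
  exact hs ▸ hiu.trans_le (h.mono hu ⟨ht.1.trans hts.le, hsT.le⟩ hus.le)

lemma firstPassage_le_iff (h : IsCountingPath T f) (hT : 0 ≤ T) (hi : i < f T) (t : ℝ) :
    firstPassage T f i ≤ t ↔ i < f (projIcc 0 T hT t) := by
  have hpos : ¬ firstPassage T f i ≤ 0 := by
    rw [h.firstPassage_le_iff_of_mem hi (left_mem_Icc.2 hT), h.zero]
    exact Nat.not_lt_zero i
  rw [← h.firstPassage_le_iff_of_mem hi (projIcc 0 T hT t).2, coe_projIcc, le_max_iff, le_min_iff]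
  simp [hpos, firstPassage_le (right_mem_Icc.2 hT) hi]

lemma setOf_firstPassage_le (h : IsCountingPath T f) (hT : 0 ≤ T) (t : ℝ) :
    {i | i < f T ∧ firstPassage T f i ≤ t} = {i | i < f (projIcc 0 T hT t)} := by
  ext i
  exact ⟨fun hi => (h.firstPassage_le_iff hT hi.1 t).1 hi.2, fun hi =>
    have ht := (projIcc 0 T hT t).2
    have hiT := hi.trans_le (h.mono ht (right_mem_Icc.2 hT) ht.2)
    ⟨hiT, (h.firstPassage_le_iff hT hiT t).2 hi⟩⟩

end IsCountingPath

end CountingPath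

/-- The intensity measure of the arrival times up to time `T` of a Poisson process of
intensity `lam`. -/
noncomputable def arrivalIntensity (T lam : ℝ) : Measure ℝ :=
  ENNReal.ofReal lam • volume.restrict (Ioc 0 T)

instance (T lam : ℝ) : IsFiniteMeasure (arrivalIntensity T lam) :=
  Measure.smul_finite _ ENNReal.ofReal_ne_top

lemma arrivalIntensity_Iic {T : ℝ} (hT : 0 ≤ T) (lam t : ℝ) :
    arrivalIntensity T lam (Iic t)
      = ENNReal.ofReal lam * ENNReal.ofReal (projIcc 0 T hT t) := by
  rw [arrivalIntensity, Measure.smul_apply, Measure.restrict_apply measurableSet_Iic, smul_eq_mul,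
    inter_comm, Ioc_inter_Iic, Real.volume_Ioc, sub_zero, coe_projIcc, ENNReal.ofReal_max,
    ENNReal.ofReal_zero, zero_max]

namespace IsPoissonProcess

variable {Ω : Type*} [MeasurableSpace Ω] {P : Measure Ω} {T lam : ℝ} {N : ℝ → Ω → ℕ} {s t : ℝ}

lemma ae_isCountingPath (h : IsPoissonProcess P T lam N) :
    ∀ᵐ ω ∂P, IsCountingPath T fun t => N t ω := by
  filter_upwards [h.zero, h.mono, h.rightCont] with ω h0 h1 h2 using ⟨h0, h1, h2⟩

lemma hasLaw_eval (h : IsPoissonProcess P T lam N) (ht : t ∈ Icc 0 T) :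
    HasLaw (N t) (poissonMeasure (lam * t).toNNReal) P := by
  have hlaw := h.law 0 t le_rfl ht.1 ht.2
  rw [sub_zero] at hlaw
  refine hlaw.congr ?_
  filter_upwards [h.zero] with ω hω
  simp [hω]

lemma lintegral_eval (h : IsPoissonProcess P T lam N) (ht : t ∈ Icc 0 T) :
    ∫⁻ ω, (N t ω : ℝ≥0∞) ∂P = ENNReal.ofReal lam * ENNReal.ofReal t := by
  rw [(h.hasLaw_eval ht).lintegral_comp (f := fun n : ℕ => (n : ℝ≥0∞))
    Measurable.of_discrete.aemeasurable, lintegral_natCast_poissonMeasure,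
    ← ENNReal.ofReal_mul' ht.1]
  rfl

lemma lintegral_eval_mul_pred (h : IsPoissonProcess P T lam N) (ht : t ∈ Icc 0 T) :
    ∫⁻ ω, (N t ω : ℝ≥0∞) * (N t ω - 1 : ℕ) ∂P
      = (ENNReal.ofReal lam * ENNReal.ofReal t) * (ENNReal.ofReal lam * ENNReal.ofReal t) := by
  rw [(h.hasLaw_eval ht).lintegral_comp (f := fun n : ℕ => (n : ℝ≥0∞) * (n - 1 : ℕ))
    Measurable.of_discrete.aemeasurable, lintegral_natCast_mul_pred_poissonMeasure,
    ← ENNReal.ofReal_mul' ht.1]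
  rfl

lemma lintegral_increment (h : IsPoissonProcess P T lam N) (hs : 0 ≤ s) (hst : s ≤ t)
    (ht : t ≤ T) :
    ∫⁻ ω, ((N t ω - N s ω : ℕ) : ℝ≥0∞) ∂P = ENNReal.ofReal lam * ENNReal.ofReal (t - s) := by
  rw [(h.law s t hs hst ht).lintegral_comp (f := fun n : ℕ => (n : ℝ≥0∞))
    Measurable.of_discrete.aemeasurable, lintegral_natCast_poissonMeasure,
    ← ENNReal.ofReal_mul' (sub_nonneg.2 hst)]
  rfl

lemma indepFun_increment (h : IsPoissonProcess P T lam N) (hs : 0 ≤ s) (hst : s ≤ t)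
    (ht : t ≤ T) : IndepFun (N s) (fun ω => N t ω - N s ω) P := by
  have hind := h.indepIncrements.indepFun_eval_sub (r := ⟨0, le_rfl, hs.trans (hst.trans ht)⟩)
    (s := ⟨s, hs, hst.trans ht⟩) (t := ⟨t, hs.trans hst, ht⟩) hs hst
    (by filter_upwards [h.zero] with ω hω using by simp [hω])
  refine (hind.comp (φ := Int.toNat) (ψ := Int.toNat) .of_discrete .of_discrete).congr ?_ ?_
  · exact ae_of_all _ fun ω => by simp
  · exact ae_of_all _ fun ω => by simp

lemma lintegral_eval_mul_increment (h : IsPoissonProcess P T lam N) (hs : 0 ≤ s) (hst : s ≤ t)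
    (ht : t ≤ T) :
    ∫⁻ ω, (N s ω : ℝ≥0∞) * (N t ω - N s ω : ℕ) ∂P
      = (ENNReal.ofReal lam * ENNReal.ofReal s)
        * (ENNReal.ofReal lam * ENNReal.ofReal (t - s)) := by
  have hsT : s ∈ Icc 0 T := ⟨hs, hst.trans ht⟩
  rw [← h.lintegral_eval hsT, ← h.lintegral_increment hs hst ht]
  exact lintegral_mul_eq_lintegral_mul_lintegral_of_indepFun
    (Measurable.of_discrete.comp (h.measurable s hsT))
    (Measurable.of_discrete.comp ((h.measurable t ⟨hs.trans hst, ht⟩).sub (h.measurable s hsT)))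
    ((h.indepFun_increment hs hst ht).comp (φ := fun n : ℕ => (n : ℝ≥0∞))
      (ψ := fun n : ℕ => (n : ℝ≥0∞)) .of_discrete .of_discrete)

lemma lintegral_eval_mul_eval_sub_min (h : IsPoissonProcess P T lam N) (hs : s ∈ Icc 0 T)
    (ht : t ∈ Icc 0 T) :
    ∫⁻ ω, ((N s ω * N t ω - min (N s ω) (N t ω) : ℕ) : ℝ≥0∞) ∂P
      = (ENNReal.ofReal lam * ENNReal.ofReal s) * (ENNReal.ofReal lam * ENNReal.ofReal t) := by
  wlog hst : s ≤ t generalizing s t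
  · simp_rw [mul_comm (N s _), min_comm (N s _)]
    rw [this ht hs (le_of_not_ge hst), mul_comm]
  have hsplit : ∀ᵐ ω ∂P, ((N s ω * N t ω - min (N s ω) (N t ω) : ℕ) : ℝ≥0∞)
      = (N s ω : ℝ≥0∞) * (N s ω - 1 : ℕ) + (N s ω : ℝ≥0∞) * (N t ω - N s ω : ℕ) := by
    filter_upwards [h.mono] with ω hω
    obtain ⟨k, hk : N t ω = N s ω + k⟩ := Nat.exists_eq_add_of_le (hω hs ht hst)
    rw [hk, min_eq_left le_self_add, Nat.add_sub_cancel_left, mul_add,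
      Nat.sub_add_comm (Nat.le_mul_self _), ← Nat.mul_sub_one]
    push_cast
    rfl
  have hmeas : Measurable fun ω => (N s ω : ℝ≥0∞) * (N s ω - 1 : ℕ) :=
    Measurable.of_discrete (f := fun n : ℕ => (n : ℝ≥0∞) * (n - 1 : ℕ)).comp (h.measurable s hs)
  rw [lintegral_congr_ae hsplit, lintegral_add_left hmeas, h.lintegral_eval_mul_pred hs,
    h.lintegral_eval_mul_increment hs.1 hst ht.2, ← mul_add, ← mul_add,
    ← ENNReal.ofReal_add hs.1 (sub_nonneg.2 hst), add_sub_cancel]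

lemma measurableSet_lt_eval (h : IsPoissonProcess P T lam N) (ht : t ∈ Icc 0 T) (i : ℕ) :
    MeasurableSet {ω | i < N t ω} :=
  measurableSet_lt measurable_const (h.measurable t ht)

lemma measurable_path (h : IsPoissonProcess P T lam N) :
    Measurable fun ω (t : Icc 0 T) => N t ω :=
  measurable_pi_lambda _ fun t => h.measurable t t.2

lemma firstPassage_ae_eq (h : IsPoissonProcess P T lam N) (hT : 0 ≤ T) (i : ℕ) :
    (fun ω => firstPassage T (fun t => N t ω) i) =ᵐ[P.restrict {ω | i < N T ω}]
      fun ω => ratFirstPassage hT i fun t => N t ω := by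
  filter_upwards [ae_restrict_of_ae h.mono,
    ae_restrict_mem (h.measurableSet_lt_eval (right_mem_Icc.2 hT) i)] with ω hω hi
  exact firstPassage_eq_ratFirstPassage hT hω hi

lemma aemeasurable_firstPassage (h : IsPoissonProcess P T lam N) (hT : 0 ≤ T) (i : ℕ) :
    AEMeasurable (fun ω => firstPassage T (fun t => N t ω) i) (P.restrict {ω | i < N T ω}) :=
  ⟨_, (measurable_ratFirstPassage hT i).comp h.measurable_path, h.firstPassage_ae_eq hT i⟩

lemma intensityMeasure_firstPassage (h : IsPoissonProcess P T lam N) (hT : 0 ≤ T) :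
    intensityMeasure P (fun i => {ω | i < N T ω}) (fun i ω => firstPassage T (fun t => N t ω) i)
      = arrivalIntensity T lam := by
  refine (Measure.ext_of_Iic _ _ fun t => ?_).symm
  rw [intensityMeasure_apply (h.measurableSet_lt_eval (right_mem_Icc.2 hT))
    (h.aemeasurable_firstPassage hT) measurableSet_Iic, arrivalIntensity_Iic hT,
    ← h.lintegral_eval (projIcc 0 T hT t).2]
  refine lintegral_congr_ae ?_
  filter_upwards [h.ae_isCountingPath] with ω hω
  simp only [mem_Iic, hω.setOf_firstPassage_le hT t]
  change _ = ((Iio (N (projIcc 0 T hT t) ω)).encard : ℝ≥0∞)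
  rw [← Finset.coe_Iio, encard_coe_eq_coe_finsetCard, Nat.card_Iio]
  rfl

lemma pairIntensity_firstPassage (h : IsPoissonProcess P T lam N) (hT : 0 ≤ T) :
    intensityMeasure P (pairEvent fun i => {ω | i < N T ω})
        (pairPoint fun i ω => firstPassage T (fun t => N t ω) i)
      = (arrivalIntensity T lam).prod (arrivalIntensity T lam) := by
  refine prod_eq_of_Iic fun s t => ?_
  have hcount : ∀ᵐ ω ∂P, {p | ω ∈ pairEvent (fun i => {ω | i < N T ω}) p ∧
      pairPoint (fun i ω => firstPassage T (fun t => N t ω) i) p ω ∈ Iic s ×ˢ Iic t}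
      = {p : {p : ℕ × ℕ // p.1 ≠ p.2} |
          p.1.1 < N (projIcc 0 T hT s) ω ∧ p.1.2 < N (projIcc 0 T hT t) ω} := by
    filter_upwards [h.ae_isCountingPath] with ω hω
    ext p
    have hfst := Set.ext_iff.1 (hω.setOf_firstPassage_le hT s) p.1.1
    have hsnd := Set.ext_iff.1 (hω.setOf_firstPassage_le hT t) p.1.2
    simp only [mem_ofPred_eq] at hfst hsnd ⊢
    simp only [pairEvent, pairPoint, mem_inter_iff, mem_ofPred_eq, mem_prod, mem_Iic, ← hfst,
      ← hsnd]
    tauto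
  rw [intensityMeasure_apply
    (measurableSet_pairEvent (h.measurableSet_lt_eval (right_mem_Icc.2 hT)))
    (aemeasurable_pairPoint (h.aemeasurable_firstPassage hT))
    (measurableSet_Iic.prod measurableSet_Iic), arrivalIntensity_Iic hT, arrivalIntensity_Iic hT,
    ← h.lintegral_eval_mul_eval_sub_min (projIcc 0 T hT s).2 (projIcc 0 T hT t).2]
  refine lintegral_congr_ae (hcount.mono fun ω hω => ?_)
  simp only [hω, encard_offDiag_lt_lt]
  rfl

lemma hasPoissonMoments_firstPassage (h : IsPoissonProcess P T lam N) (hT : 0 ≤ T) :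
    HasPoissonMoments P (fun i => {ω | i < N T ω})
      (fun i ω => firstPassage T (fun t => N t ω) i) (arrivalIntensity T lam) where
  measurableSet := h.measurableSet_lt_eval (right_mem_Icc.2 hT)
  aemeasurable := h.aemeasurable_firstPassage hT
  intensity_eq := h.intensityMeasure_firstPassage hT
  pairIntensity_eq := h.pairIntensity_firstPassage hT

end IsPoissonProcess

namespace ClaimModel

variable {Ω : Type*} [MeasurableSpace Ω] {P : Measure Ω} (M : ClaimModel P)

lemma ae_pos : ∀ᵐ y ∂M.F, 0 < y := by
  rw [← (M.Y_law 0).map_eq, ae_map_iff (M.Y_law 0).aemeasurable measurableSet_Ioi]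
  exact M.Y_pos 0

lemma restrict_Ioi_F : M.F.restrict (Ioi 0) = M.F :=
  Measure.restrict_eq_self_of_ae_mem M.ae_pos

instance isProbabilityMeasure_F [IsProbabilityMeasure P] : IsProbabilityMeasure M.F :=
  (M.Y_law 0).isProbabilityMeasure_iff.1 inferInstance

lemma memLp_id_F : MemLp (fun y : ℝ => y) 2 M.F :=
  (memLp_two_iff_integrable_sq measurable_id.aestronglyMeasurable).2 M.Y_sq

/-- The intensity measure of the claims in `(t,T]`, as points (arrival time, size). -/
noncomputable def claimIntensity (t : ℝ) : Measure (ℝ × ℝ) :=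
  ((arrivalIntensity M.T M.lam).prod M.F).restrict (Ioc t M.T ×ˢ Ioi 0)

instance [IsProbabilityMeasure P] (t : ℝ) : IsFiniteMeasure (M.claimIntensity t) := by
  unfold claimIntensity
  infer_instance

lemma claimIntensity_eq [IsProbabilityMeasure P] {t : ℝ} (ht : 0 ≤ t) :
    M.claimIntensity t
      = ENNReal.ofReal M.lam • (volume.restrict (Ioc t M.T)).prod M.F := by
  rw [claimIntensity, ← Measure.prod_restrict, M.restrict_Ioi_F, arrivalIntensity,
    Measure.restrict_smul, Measure.restrict_restrict measurableSet_Ioc,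
    inter_eq_left.2 (Ioc_subset_Ioc_left ht), Measure.prod_smul_left]

lemma integral_claimIntensity [IsProbabilityMeasure P] {t : ℝ} (ht : 0 ≤ t) (g : ℝ × ℝ → ℝ) :
    ∫ z, g z ∂M.claimIntensity t
      = M.lam * ∫ z, g z ∂(volume.restrict (Ioc t M.T)).prod M.F := by
  rw [M.claimIntensity_eq ht, integral_smul_measure, ENNReal.toReal_ofReal M.lam_pos.le,
    smul_eq_mul]

lemma memLp_snd_claimIntensity [IsProbabilityMeasure P] (t : ℝ) :
    MemLp (fun z : ℝ × ℝ => z.2) 2 (M.claimIntensity t) :=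
  (M.memLp_id_F.comp_snd _).restrict _

namespace IsCoverage

variable {M} {l : ℝ → ℝ → ℝ} [IsProbabilityMeasure P] {t : ℝ}

lemma memLp_prod (hl : M.IsCoverage l) (ht : 0 ≤ t) :
    MemLp (fun z : ℝ × ℝ => l z.1 z.2) 2 ((volume.restrict (Ioc t M.T)).prod M.F) :=
  ((memLp_two_iff_integrable_sq hl.measurable.aestronglyMeasurable).2
    hl.sq_integrable).mono_measure (Measure.prod_mono (Measure.restrict_mono
      (Ioc_subset_Icc_self.trans (Icc_subset_Icc_left ht)) le_rfl) le_rfl)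

lemma memLp_claimIntensity (hl : M.IsCoverage l) (ht : 0 ≤ t) :
    MemLp (fun z : ℝ × ℝ => l z.1 z.2) 2 (M.claimIntensity t) := by
  rw [M.claimIntensity_eq ht]
  exact (hl.memLp_prod ht).smul_measure ENNReal.ofReal_ne_top

end IsCoverage

lemma hasPoissonMoments_claims [IsProbabilityMeasure P] :
    HasPoissonMoments P (fun i => {ω | i < M.N M.T ω}) (fun i ω => (M.arrival i ω, M.Y i ω))
      ((arrivalIntensity M.T M.lam).prod M.F) := by
  have hT := M.T_pos.le
  have harrival := M.poisson.firstPassage_ae_eq hT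
  refine (((M.poisson.hasPoissonMoments_firstPassage hT).congr fun i => (harrival i).symm).marked
    (W := fun ω (t : Icc 0 M.T) => M.N t ω) (B := fun i => {w | i < w ⟨M.T, right_mem_Icc.2 hT⟩})
    (a := ratFirstPassage hT) M.poisson.measurable_path
    (fun i => measurableSet_lt measurable_const (measurable_pi_apply _))
    (measurable_ratFirstPassage hT) M.Y_law (fun i j hij => M.Y_indep.indepFun hij)
    M.N_Y_indep).congr fun i => ?_
  filter_upwards [harrival i] with ω hω
  exact congrArg (·, M.Y i ω) hω

section ClaimSum

/-- The sum of `g` over the claims in `(t,T]`, as points (arrival time, size). -/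
noncomputable def claimSum (g : ℝ × ℝ → ℝ) (t : ℝ) (ω : Ω) : ℝ :=
  ∫ z in Ioc t M.T ×ˢ Ioi 0, g z ∂M.jumpMeasure ω

lemma claimSum_eq_shotNoise (g : ℝ × ℝ → ℝ) (t : ℝ) :
    M.claimSum g t = shotNoise (fun i => {ω | i < M.N M.T ω})
      (fun i ω => (M.arrival i ω, M.Y i ω)) ((Ioc t M.T ×ˢ Ioi 0).indicator g) := by
  ext ω
  rw [claimSum, ← integral_indicator (measurableSet_Ioc.prod measurableSet_Ioi), jumpMeasure,
    integral_finsetSum_measure fun i _ => integrable_dirac (by simp), shotNoise,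
    tsum_eq_sum (s := Finset.range (M.N M.T ω))
      fun i hi => indicator_of_notMem (by simpa using hi) _]
  refine Finset.sum_congr rfl fun i hi => ?_
  have hi_mem : ω ∈ {ω | i < M.N M.T ω} := Finset.mem_range.1 hi
  rw [integral_dirac, indicator_of_mem hi_mem]

variable {M} {g : ℝ × ℝ → ℝ} {t : ℝ}

lemma memLp_indicator_of_claimIntensity (hg : MemLp g 2 (M.claimIntensity t)) :
    MemLp ((Ioc t M.T ×ˢ Ioi 0).indicator g) 2 ((arrivalIntensity M.T M.lam).prod M.F) :=
  (memLp_indicator_iff_restrict (measurableSet_Ioc.prod measurableSet_Ioi)).2 hg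

variable [IsProbabilityMeasure P]

lemma memLp_claimSum (hg : MemLp g 2 (M.claimIntensity t)) : MemLp (M.claimSum g t) 2 P := by
  rw [claimSum_eq_shotNoise]
  exact M.hasPoissonMoments_claims.memLp_shotNoise
    ((memLp_indicator_of_claimIntensity hg).integrable one_le_two)
    (memLp_indicator_of_claimIntensity hg)

lemma integral_claimSum (hg : MemLp g 2 (M.claimIntensity t)) :
    ∫ ω, M.claimSum g t ω ∂P = ∫ z, g z ∂M.claimIntensity t := by
  rw [claimSum_eq_shotNoise, M.hasPoissonMoments_claims.integral_shotNoise
    ((memLp_indicator_of_claimIntensity hg).integrable one_le_two),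
    integral_indicator (measurableSet_Ioc.prod measurableSet_Ioi), claimIntensity]

lemma variance_claimSum (hg : MemLp g 2 (M.claimIntensity t)) :
    variance (M.claimSum g t) P = ∫ z, g z ^ 2 ∂M.claimIntensity t := by
  have hsq z : (Ioc t M.T ×ˢ Ioi (0 : ℝ)).indicator g z ^ 2
      = (Ioc t M.T ×ˢ Ioi (0 : ℝ)).indicator (fun z => g z ^ 2) z := by
    by_cases hz : z ∈ Ioc t M.T ×ˢ Ioi (0 : ℝ) <;> simp [hz]
  rw [claimSum_eq_shotNoise, M.hasPoissonMoments_claims.variance_shotNoise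
    ((memLp_indicator_of_claimIntensity hg).integrable one_le_two)
    (memLp_indicator_of_claimIntensity hg)]
  simp_rw [hsq]
  rw [integral_indicator (measurableSet_Ioc.prod measurableSet_Ioi), claimIntensity]

end ClaimSum

end ClaimModel

section Cost

/-- The mean-variance cost, per unit of intensity, of a claim of size `y` of which `c` is covered:
the claim itself, the loading `xi * c` and the penalty on the square of the retained part. -/
noncomputable def cost (xi γ y c : ℝ) : ℝ :=
  y + xi * c + γ / 2 * (y - c) ^ 2

lemma cost_max_sub_zero_le {γ d y c : ℝ} (hγ : 0 ≤ γ) (hc : 0 ≤ c) :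
    cost (γ * d) γ y (max (y - d) 0) ≤ cost (γ * d) γ y c := by
  rcases le_total y d with hy | hy
  · have hdiff : cost (γ * d) γ y c
        = cost (γ * d) γ y 0 + (γ * (c * (d - y)) + γ / 2 * c ^ 2) := by unfold cost; ring
    rw [max_eq_right (sub_nonpos.2 hy), hdiff]
    exact le_add_of_nonneg_right
      (add_nonneg (mul_nonneg hγ (mul_nonneg hc (sub_nonneg.2 hy))) (by positivity))
  · have hdiff : cost (γ * d) γ y c
        = cost (γ * d) γ y (y - d) + γ / 2 * (y - c - d) ^ 2 := by unfold cost; ring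
    rw [max_eq_left (sub_nonneg.2 hy), hdiff]
    exact le_add_of_nonneg_right (by positivity)

variable {α : Type*} [MeasurableSpace α] {μ : Measure α} [IsFiniteMeasure μ] {y c : α → ℝ}

lemma integrable_cost (hy : MemLp y 2 μ) (hc : MemLp c 2 μ) (xi γ : ℝ) :
    Integrable (fun z => cost xi γ (y z) (c z)) μ :=
  ((hy.integrable one_le_two).add ((hc.integrable one_le_two).const_mul xi)).add
    ((hy.sub hc).integrable_sq.const_mul (γ / 2))

lemma integral_cost (hy : MemLp y 2 μ) (hc : MemLp c 2 μ) (xi γ : ℝ) :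
    ∫ z, cost xi γ (y z) (c z) ∂μ
      = ∫ z, y z ∂μ + xi * ∫ z, c z ∂μ + γ / 2 * ∫ z, (y z - c z) ^ 2 ∂μ := by
  have hy' := hy.integrable one_le_two
  have hc' := (hc.integrable one_le_two).const_mul xi
  have hyc : Integrable (fun z => y z + xi * c z) μ := hy'.add hc'
  have hsq : Integrable (fun z => γ / 2 * (y z - c z) ^ 2) μ :=
    (hy.sub hc).integrable_sq.const_mul (γ / 2)
  unfold cost
  rw [integral_add hyc hsq, integral_add hy' hc', integral_const_mul,
    integral_const_mul]

end Cost

lemma setIntegral_Ioi_sub (μ : Measure ℝ) (d : ℝ) :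
    ∫ y in Ioi d, (y - d) ∂μ = ∫ y, max (y - d) 0 ∂μ := by
  rw [← integral_indicator measurableSet_Ioi]
  congr 1 with y
  rcases lt_or_ge d y with h | h
  · rw [indicator_of_mem (mem_Ioi.2 h), max_eq_left (sub_nonneg.2 h.le)]
  · rw [indicator_of_notMem (notMem_Ioi.2 h), max_eq_right (sub_nonpos.2 h)]

lemma sub_max_sub_zero (y d : ℝ) : y - max (y - d) 0 = min y d := by
  rw [← min_sub_sub_left, sub_sub_cancel, sub_zero, min_comm]

namespace ClaimModel

variable {Ω : Type*} [MeasurableSpace Ω] {P : Measure Ω} (M : ClaimModel P)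

section MeanVariance

variable [IsProbabilityMeasure P] {l : ℝ → ℝ → ℝ} {t : ℝ}

lemma integral_premiumRate (hl : M.IsCoverage l) (xi : ℝ) (ht : t ∈ Icc 0 M.T) :
    ∫ s in t..M.T, M.premiumRate xi l s = (1 + xi) * ∫ z, l z.1 z.2 ∂M.claimIntensity t := by
  unfold premiumRate
  rw [intervalIntegral.integral_of_le ht.2, integral_const_mul, M.restrict_Ioi_F,
    M.integral_claimIntensity ht.1, mul_assoc,
    integral_prod _ ((hl.memLp_prod ht.1).integrable one_le_two)]

lemma memLp_retained (hl : M.IsCoverage l) (ht : 0 ≤ t) :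
    MemLp (fun z : ℝ × ℝ => z.2 - l z.1 z.2) 2 (M.claimIntensity t) :=
  (M.memLp_snd_claimIntensity t).sub (hl.memLp_claimIntensity ht)

lemma memLp_surplusFrom (hl : M.IsCoverage l) (xi x : ℝ) (ht : 0 ≤ t) :
    MemLp (M.surplusFrom xi l t x M.T) 2 P :=
  (memLp_const (x - ∫ s in t..M.T, M.premiumRate xi l s)).sub
    (memLp_claimSum (M.memLp_retained hl ht))

lemma integral_surplusFrom (hl : M.IsCoverage l) (xi x : ℝ) (ht : t ∈ Icc 0 M.T) :
    ∫ ω, M.surplusFrom xi l t x M.T ω ∂P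
      = x - (∫ z, z.2 ∂M.claimIntensity t + xi * ∫ z, l z.1 z.2 ∂M.claimIntensity t) := by
  have hretained := M.memLp_retained hl ht.1
  have hmean : ∫ ω, M.surplusFrom xi l t x M.T ω ∂P = x - (∫ s in t..M.T, M.premiumRate xi l s)
      - ∫ z, (z.2 - l z.1 z.2) ∂M.claimIntensity t := by
    rw [← integral_claimSum hretained]
    exact (integral_sub (integrable_const _)
      ((memLp_claimSum hretained).integrable one_le_two)).trans (by simp)
  rw [hmean, M.integral_premiumRate hl xi ht, integral_sub
    ((M.memLp_snd_claimIntensity t).integrable one_le_two)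
    ((hl.memLp_claimIntensity ht.1).integrable one_le_two)]
  ring

lemma variance_surplusFrom (hl : M.IsCoverage l) (xi x : ℝ) (ht : 0 ≤ t) :
    variance (M.surplusFrom xi l t x M.T) P
      = ∫ z, (z.2 - l z.1 z.2) ^ 2 ∂M.claimIntensity t := by
  have hretained := M.memLp_retained hl ht
  rw [← variance_claimSum hretained]
  exact variance_const_sub (memLp_claimSum hretained).1 _

lemma J_eq (hl : M.IsCoverage l) (xi γ x : ℝ) (ht : t ∈ Icc 0 M.T) :
    M.J xi γ t x l = x - ∫ z, cost xi γ z.2 (l z.1 z.2) ∂M.claimIntensity t := by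
  rw [J, M.integral_surplusFrom hl xi x ht, M.variance_surplusFrom hl xi x ht.1,
    integral_cost (M.memLp_snd_claimIntensity t) (hl.memLp_claimIntensity ht.1)]
  ring

end MeanVariance

section ExcessOfLoss

lemma isIndemnity_excessOfLoss {d : ℝ} (hd : 0 ≤ d) : M.IsIndemnity (excessOfLoss d) where
  measurable := by
    unfold excessOfLoss Function.uncurry
    fun_prop
  bounds _ _ y hy := ⟨le_max_right _ _, max_le (sub_le_self y hd) hy.le⟩

variable [IsProbabilityMeasure P]

lemma J_le_J_excessOfLoss {xi γ : ℝ} (hγ : 0 < γ) {l : ℝ → ℝ → ℝ} (hl : M.IsCoverage l)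
    (hd : M.IsCoverage (excessOfLoss (xi / γ))) {t : ℝ} (ht : t ∈ Icc 0 M.T) (x : ℝ) :
    M.J xi γ t x l ≤ M.J xi γ t x (excessOfLoss (xi / γ)) := by
  have hy := M.memLp_snd_claimIntensity t
  rw [M.J_eq hl xi γ x ht, M.J_eq hd xi γ x ht]
  refine sub_le_sub_left (integral_mono_ae
    (integrable_cost hy (hd.memLp_claimIntensity ht.1) xi γ)
    (integrable_cost hy (hl.memLp_claimIntensity ht.1) xi γ) ?_) x
  filter_upwards [ae_restrict_mem (measurableSet_Ioc.prod measurableSet_Ioi)] with z hz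
  have hcov : 0 ≤ l z.1 z.2 := hl.nonneg z.1 ⟨ht.1.trans hz.1.1.le, hz.1.2⟩ z.2 hz.2
  have hcost := cost_max_sub_zero_le (d := xi / γ) (y := z.2) hγ.le hcov
  rw [mul_div_cancel₀ xi hγ.ne'] at hcost
  exact hcost

lemma J_excessOfLoss {d : ℝ} (hd : M.IsCoverage (excessOfLoss d)) (xi γ x : ℝ) :
    M.J xi γ 0 x (excessOfLoss d) = x - M.lam * M.T * ((∫ y, y ∂M.F)
        + xi * (∫ y in Ioi d, (y - d) ∂M.F) + γ / 2 * ∫ y in Ioi 0, (min y d) ^ 2 ∂M.F) := by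
  have hcov : MemLp (fun y : ℝ => max (y - d) 0) 2 M.F :=
    (M.memLp_id_F.sub (memLp_const d)).pos_part
  rw [M.J_eq hd xi γ x ⟨le_rfl, M.T_pos.le⟩, M.integral_claimIntensity le_rfl]
  unfold excessOfLoss
  rw [integral_fun_snd fun y => cost xi γ y (max (y - d) 0), integral_cost M.memLp_id_F hcov,
    ← setIntegral_Ioi_sub, M.restrict_Ioi_F]
  simp_rw [sub_max_sub_zero]
  simp [M.T_pos.le, mul_assoc]

end ExcessOfLoss

section Optimality

variable {M} {A : Set (ℝ → ℝ → ℝ)} {xi γ : ℝ} {l : ℝ → ℝ → ℝ}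

lemma isEquilibrium_of_forall_isMaxOn (hl : l ∈ A)
    (hmax : ∀ t ∈ Icc 0 M.T, ∀ x, IsMaxOn (M.J xi γ t x) A l) : M.IsEquilibrium A xi γ l := by
  refine ⟨hl, fun t ht x lbar hlbar => le_liminf_of_le (by isBoundedDefault) ?_⟩
  filter_upwards [hlbar, self_mem_nhdsWithin] with ε hε hε_pos
  exact EReal.coe_nonneg.2 (div_nonneg (sub_nonneg.2 (hmax t ht x hε)) (le_of_lt hε_pos))

lemma valueFunction_eq_of_isMaxOn {xC : ℝ} (hl : l ∈ A)
    (hmax : IsMaxOn (M.objective xi γ xC) A l) :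
    M.valueFunction A xi γ xC = (M.objective xi γ xC l : EReal) :=
  le_antisymm (iSup₂_le fun _ hl' => EReal.coe_le_coe_iff.2 (hmax hl'))
    (le_iSup₂ (f := fun l _ => ((M.objective xi γ xC l : ℝ) : EReal)) l hl)

end Optimality

end ClaimModel

theorem theorem3p2 {Ω : Type*} [MeasurableSpace Ω] (P : Measure Ω) [IsProbabilityMeasure P]
    (M : ClaimModel P)
    -- the admissible set: any class between the two natural ones
    (A : Set (ℝ → ℝ → ℝ)) (hA₁ : ∀ l, M.IsIndemnity l → l ∈ A) (hA₂ : ∀ l ∈ A, M.IsCoverage l)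
    (γL γH : ℝ) (hγL : 0 ≤ γL) (xC : ℝ) (hxC : 0 < xC)
    -- the admissible loading function, the true and the reported risk aversion
    (ξ : ℝ → ℝ) (hξ : ∀ g ∈ Icc γL γH, 0 ≤ ξ g)
    (γ : ℝ) (hγ : γ ∈ Icc γL γH) (hγ_pos : 0 < γ) (γ' : ℝ) (hγ' : γ' ∈ Icc γL γH) :
    -- all means and variances involved are finite
    (∀ l ∈ A, ∀ t ∈ Icc 0 M.T, ∀ x : ℝ, MemLp (M.surplusFrom (ξ γ') l t x M.T) 2 P) ∧
    -- `(y - ξ(γ')/γ)_+` is an equilibrium strategy, and it attains the supremum of the objective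
    M.IsEquilibrium A (ξ γ') γ (excessOfLoss (ξ γ' / γ)) ∧
    IsMaxOn (M.objective (ξ γ') γ xC) A (excessOfLoss (ξ γ' / γ)) ∧
    -- the value function is the (equilibrium) value of that strategy, given explicitly
    M.valueFunction A (ξ γ') γ xC = (M.J (ξ γ') γ 0 xC (excessOfLoss (ξ γ' / γ)) : EReal) ∧
    M.J (ξ γ') γ 0 xC (excessOfLoss (ξ γ' / γ)) =
      xC - M.lam * M.T * ((∫ y, y ∂M.F)
        + ξ γ' * (∫ y in Ioi (ξ γ' / γ), (y - ξ γ' / γ) ∂M.F)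
        + γ / 2 * ∫ y in Ioi 0, (min y (ξ γ' / γ)) ^ 2 ∂M.F) := by
  have hA : excessOfLoss (ξ γ' / γ) ∈ A :=
    hA₁ _ (M.isIndemnity_excessOfLoss (div_nonneg (hξ γ' hγ') hγ_pos.le))
  have hJ (t) (ht : t ∈ Icc 0 M.T) (x : ℝ) :
      IsMaxOn (M.J (ξ γ') γ t x) A (excessOfLoss (ξ γ' / γ)) := fun l hl =>
    M.J_le_J_excessOfLoss hγ_pos (hA₂ l hl) (hA₂ _ hA) ht x
  have hobjective : IsMaxOn (M.objective (ξ γ') γ xC) A (excessOfLoss (ξ γ' / γ)) :=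
    hJ 0 (left_mem_Icc.2 M.T_pos.le) xC
  exact ⟨fun l hl t ht x => M.memLp_surplusFrom (hA₂ l hl) _ x ht.1,
    ClaimModel.isEquilibrium_of_forall_isMaxOn hA hJ, hobjective,
    ClaimModel.valueFunction_eq_of_isMaxOn hA hobjective, M.J_excessOfLoss (hA₂ _ hA) _ _ _⟩
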